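/- Let $Q$ be a finite-dimensional smooth manifold, $L:TQ\to\mathbb{R}$ a smooth function, and $i:M\hookrightarrow TQ$ an embedded smooth submanifold. Let $pr_1,pr_2$ be the projections of the Whitney sum $T^*Q\oplus TQ$ onto $T^*Q$ and $TQ$. Let $W_0=T^*Q\times_Q M=pr_2^{-1}(M)$, with inclusion $j:W_0\hookrightarrow T^*Q\oplus TQ$ and projections $\pi_1:W_0\to T^*Q$, $\pi_2:W_0\to M$. Let $\theta_Q$ be the Liouville form on $T^*Q$ and $\omega_Q=-d\theta_Q$ (in coordinates $dq^A\wedge dp_A$). Let $S$ be the canonical vertical endomorphism of $T(TQ)$, let $Leg_L:TQ\to T^*Q$ be the fibre derivative of $L$, and put $\omega_L=-d(S^*dL)$, $E_L(v)=\langle Leg_L(v),v\rangle-L(v)$. Define $$\omega=\pi_1^*\omega_Q,\qquad H_{W_0}=\langle \pi_1,\, i\circ\pi_2\rangle-L\circ i\circ\pi_2\quad\text{on } W_0,$$ $$\bar H=\langle pr_1,pr_2\rangle+pr_2^*E_L\ \text{ on } T^*Q\oplus TQ,\qquad \bar\omega=j^*(pr_1^*\omega_Q+pr_2^*\omega_L)\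 \text{ on } W_0,$$ and let $F:T^*Q\oplus TQ\to T^*Q\oplus TQ$, $F(\alpha,v)=(\alpha-Leg_L(v),v)$. Then $\bar\omega=\omega+(i\circ\pi_2)^*\omega_L$, the map $F$ restricts to a diffeomorphism $F|_{W_0}$ of $W_0$ (again denoted $F$ below), and the solutions of $$(1)\quad i_X\omega=dH_{W_0}\qquad\text{and}\qquad(2)\quad i_Y\bar\omega=d(j^*\bar H)$$ are $F|_{W_0}$-related. That is, for every $x\in W_0$: * if $Y\in T_xW_0$ solves (2) at $x$, then $TF^{-1}(Y)$ solves (1) at $F^{-1}(x)$; * conversely, if $X\in T_{F^{-1}(x)}W_0$ solves (1) at $F^{-1}(x)$, then $TF(X)$ solves (2) at $x$. -/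

import Mathlib

open Bundle Manifold
open scoped ContDiff Topology

noncomputable section

namespace Vakonomic

/-! ### Differential forms on manifolds -/

section Forms

variable {V H N : Type*} [NormedAddCommGroup V] [NormedSpace ℝ V] [TopologicalSpace H]
  (I : ModelWithCorners ℝ V H) [TopologicalSpace N] [ChartedSpace H N]
  {V' H' N' : Type*} [NormedAddCommGroup V'] [NormedSpace ℝ V'] [TopologicalSpace H']
  (I' : ModelWithCorners ℝ V' H') [TopologicalSpace N'] [ChartedSpace H' N']

/-- A (not necessarily smooth) differential `k`-form on the manifold `N`. -/
abbrev DiffForm (N : Type*) [TopologicalSpace N] [ChartedSpace H N] (k : ℕ) : Type _ :=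
  ∀ x : N, TangentSpace I x [⋀^Fin k]→L[ℝ] ℝ

/-- A family of linear forms on the tangent spaces, seen as a differential `1`-form. -/
def oneForm (a : ∀ x : N, TangentSpace I x →L[ℝ] ℝ) : DiffForm I N 1 :=
  fun x => ContinuousAlternatingMap.ofSubsingleton ℝ (TangentSpace I x) ℝ (0 : Fin 1) (a x)

/-- The pullback `f^* σ` of a differential form by a map of manifolds. -/
def pullback {k : ℕ} (f : N → N') (σ : DiffForm I' N' k) : DiffForm I N k :=
  fun x => (σ (f x)).compContinuousLinearMap (mfderiv I I' f x)

/-- The exterior derivative of a differential form: at each point `x`, it is the exterior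
derivative of the local representative of the form in the preferred chart at `x`,
transported back by the differential of this chart. -/
def extD {k : ℕ} (σ : DiffForm I N k) : DiffForm I N (k + 1) :=
  fun x =>
    (extDerivWithin
      (fun y : V => ((σ ((extChartAt I x).symm y)).compContinuousLinearMap
        (mfderivWithin 𝓘(ℝ, V) I (extChartAt I x).symm (Set.range I) y) :
          V [⋀^Fin k]→L[ℝ] ℝ))
      (Set.range I) (extChartAt I x x)).compContinuousLinearMap
        (mfderiv I 𝓘(ℝ, V) (extChartAt I x) x)

/-- The tangent vector `X` at `x` solves the equation `i_X σ = df` at the point `x`. -/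
def IsSolutionAt (σ : DiffForm I N 2) (f : N → ℝ) (x : N) (X : TangentSpace I x) : Prop :=
  ∀ Z : TangentSpace I x, σ x ![X, Z] = mfderiv I 𝓘(ℝ, ℝ) f x Z

end Forms

/-! ### The tangent, cotangent and Whitney sum bundles -/

section Ambient

variable {E : Type*} [NormedAddCommGroup E] [NormedSpace ℝ E]
  {Q : Type*} [TopologicalSpace Q] [ChartedSpace E Q] [IsManifold 𝓘(ℝ, E) ∞ Q]

variable (E Q) in
/-- The tangent bundle `TQ`. -/
abbrev TB : Type _ := TangentBundle 𝓘(ℝ, E) Q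

variable (E) in
/-- The cotangent space `T_x^*Q`. -/
abbrev Cotan (x : Q) : Type _ := TangentSpace 𝓘(ℝ, E) x →L[ℝ] Bundle.Trivial Q ℝ x

variable (E Q) in
/-- The cotangent bundle `T^*Q`. -/
abbrev CB : Type _ := TotalSpace (E →L[ℝ] ℝ) (fun x : Q => Cotan E x)

variable (E Q) in
/-- The Whitney sum `T^*Q ⊕ TQ`. -/
abbrev WB : Type _ :=
  TotalSpace ((E →L[ℝ] ℝ) × E)
    ((fun x : Q => Cotan E x) ×ᵇ (fun x : Q => TangentSpace 𝓘(ℝ, E) x))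

variable (E) in
/-- The model with corners of `TQ`. -/
abbrev IT : ModelWithCorners ℝ (E × E) (ModelProd E E) := 𝓘(ℝ, E).prod 𝓘(ℝ, E)

variable (E) in
/-- The model with corners of `T^*Q`. -/
abbrev IC : ModelWithCorners ℝ (E × (E →L[ℝ] ℝ)) (ModelProd E (E →L[ℝ] ℝ)) :=
  𝓘(ℝ, E).prod 𝓘(ℝ, E →L[ℝ] ℝ)

variable (E) in
/-- The model with corners of `T^*Q ⊕ TQ`. -/
abbrev IW : ModelWithCorners ℝ (E × ((E →L[ℝ] ℝ) × E)) (ModelProd E ((E →L[ℝ] ℝ) × E)) :=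
  𝓘(ℝ, E).prod 𝓘(ℝ, (E →L[ℝ] ℝ) × E)


variable (E Q) in
/-- The Liouville `1`-form on `T^*Q`, `θ_α(Z) = α(Tπ(Z))`; in coordinates `p_A dq^A`. -/
def liouville : DiffForm (IC E) (CB E Q) 1 :=
  oneForm (IC E) fun α => α.2.comp
    (mfderiv (IC E) 𝓘(ℝ, E) (TotalSpace.proj : CB E Q → Q) α)

variable (E Q) in
/-- The canonical symplectic form `ω_Q = -dθ` on `T^*Q`; in coordinates `dq^A ∧ dp_A`. -/
def omegaQ : DiffForm (IC E) (CB E Q) 2 := fun α => -extD (IC E) (liouville E Q) α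

/-- The vertical lift `T_xQ → T_v(TQ)` at `v ∈ T_xQ`, i.e. the differential at `v` of the
inclusion of the fibre `T_xQ` in `TQ`. -/
def vlift (v : TB E Q) : TangentSpace 𝓘(ℝ, E) v.1 →L[ℝ] TangentSpace (IT E) v :=
  mfderiv 𝓘(ℝ, E) (IT E) (fun w : E => (⟨v.1, w⟩ : TB E Q)) v.2

/-- The canonical vertical endomorphism `S` of `T(TQ)`; in coordinates `dq^A ⊗ ∂/∂v^A`. -/
def vertEndo (v : TB E Q) : TangentSpace (IT E) v →L[ℝ] TangentSpace (IT E) v :=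
  (vlift v).comp (mfderiv (IT E) 𝓘(ℝ, E) (TotalSpace.proj : TB E Q → Q) v)

/-- The Legendre transformation `Leg_L : TQ → T^*Q` (the fibre derivative of `L`);
in coordinates `(q^A, v^A) ↦ (q^A, ∂L/∂v^A)`. Here `Leg_L(v)` is given as an element of
`T_x^*Q`, where `v ∈ T_xQ`. -/
def legendre (L : TB E Q → ℝ) (v : TB E Q) : Cotan E v.1 :=
  fderiv ℝ (fun w : E => L ⟨v.1, w⟩) v.2

/-- The Poincaré-Cartan `2`-form `ω_L = -d(S^* dL)` on `TQ`. -/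
def omegaL (L : TB E Q → ℝ) : DiffForm (IT E) (TB E Q) 2 := fun v =>
  -extD (IT E) (oneForm (IT E) fun u =>
    ((mfderiv (IT E) 𝓘(ℝ, ℝ) L u).comp (vertEndo u) : TangentSpace (IT E) u →L[ℝ] ℝ)) v

/-- The energy `E_L(v) = ⟨Leg_L(v), v⟩ - L(v)` on `TQ`; in coordinates `v^A ∂L/∂v^A - L`. -/
def energy (L : TB E Q → ℝ) (v : TB E Q) : ℝ :=
  fderiv ℝ (fun w : E => L ⟨v.1, w⟩) v.2 v.2 - L v

/-- The projection `pr₁ : T^*Q ⊕ TQ → T^*Q`. -/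
def pr₁ (z : WB E Q) : CB E Q := ⟨z.1, z.2.1⟩

/-- The projection `pr₂ : T^*Q ⊕ TQ → TQ`. -/
def pr₂ (z : WB E Q) : TB E Q := ⟨z.1, z.2.2⟩

variable (E Q) in
/-- The presymplectic form `Ω = pr₁^* ω_Q` on `T^*Q ⊕ TQ`. -/
def Omega : DiffForm (IW E) (WB E Q) 2 := pullback (IW E) (IC E) pr₁ (omegaQ E Q)

/-- The function `H̄ = ⟨pr₁, pr₂⟩ + pr₂^* E_L` on `T^*Q ⊕ TQ`. -/
def Hbar (L : TB E Q → ℝ) (z : WB E Q) : ℝ := (z.2.1 z.2.2 : ℝ) + energy L (pr₂ z)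

/-- The fibred bijection `F : (α, v) ↦ (α - Leg_L(v), v)` of `T^*Q ⊕ TQ`. -/
def F (L : TB E Q → ℝ) : WB E Q ≃ WB E Q where
  toFun z := ⟨z.1, (HSub.hSub (α := Cotan E z.1) (β := Cotan E z.1)
    (γ := Cotan E z.1) z.2.1 (legendre L (pr₂ z)), z.2.2)⟩
  invFun z := ⟨z.1, (HAdd.hAdd (α := Cotan E z.1) (β := Cotan E z.1)
    (γ := Cotan E z.1) z.2.1 (legendre L (pr₂ z)), z.2.2)⟩
  left_inv z := congrArg (fun α : Cotan E z.1 => (⟨z.1, (α, z.2.2)⟩ : WB E Q))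
    (sub_add_cancel (G := Cotan E z.1) z.2.1 (legendre L (pr₂ z)))
  right_inv z := congrArg (fun α : Cotan E z.1 => (⟨z.1, (α, z.2.2)⟩ : WB E Q))
    (add_sub_cancel_right (G := Cotan E z.1) z.2.1 (legendre L (pr₂ z)))

end Ambient

/-! ### The constrained phase space `W₀ = T^*Q ×_Q M`

The constraint submanifold `M` of `TQ` is given by its inclusion `i : M → TQ`. -/

section Constrained

variable {E : Type*} [NormedAddCommGroup E] [NormedSpace ℝ E]
  {Q : Type*} [TopologicalSpace Q] [ChartedSpace E Q] [IsManifold 𝓘(ℝ, E) ∞ Q]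
  {E' : Type*} [NormedAddCommGroup E'] [NormedSpace ℝ E']
  {M : Type*} [TopologicalSpace M] [ChartedSpace E' M]

/-- The map `τ_Q ∘ i : M → Q`. -/
def base (i : C^∞⟮𝓘(ℝ, E'), M; IT E, TB E Q⟯) : C^∞⟮𝓘(ℝ, E'), M; 𝓘(ℝ, E), Q⟯ :=
  ⟨fun m => (i m).1, (contMDiff_proj _).comp i.contMDiff⟩

/-- The manifold `W₀ = T^*Q ×_Q M`: the total space of the pullback to `M` of the cotangent
bundle of `Q`, whose points are the pairs `(m, α)` with `m ∈ M`, `α ∈ T_x^*Q`, `x = τ_Q(i(m))`. -/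
abbrev W₀ (i : C^∞⟮𝓘(ℝ, E'), M; IT E, TB E Q⟯) : Type _ :=
  TotalSpace (E →L[ℝ] ℝ) ((base i : M → Q) *ᵖ (fun x : Q => Cotan E x))

variable (E E') in
/-- The model with corners of `W₀`. -/
abbrev IW₀ : ModelWithCorners ℝ (E' × (E →L[ℝ] ℝ)) (ModelProd E' (E →L[ℝ] ℝ)) :=
  𝓘(ℝ, E').prod 𝓘(ℝ, E →L[ℝ] ℝ)


variable (i : C^∞⟮𝓘(ℝ, E'), M; IT E, TB E Q⟯)

/-- The projection `π₁ : W₀ → T^*Q`. -/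
def π₁ (w : W₀ i) : CB E Q := ⟨(i w.1).1, w.2⟩

/-- The projection `π₂ : W₀ → M`. -/
def π₂ (w : W₀ i) : M := w.1

/-- The canonical inclusion `j : W₀ → T^*Q ⊕ TQ`. -/
def j (w : W₀ i) : WB E Q := ⟨(i w.1).1, (w.2, (i w.1).2)⟩

theorem pr₁_j (w : W₀ i) : pr₁ (j i w) = π₁ i w := rfl

theorem pr₂_j (w : W₀ i) : pr₂ (j i w) = i (π₂ i w) := rfl

/-- `j` identifies `W₀` with the subset `pr₂⁻¹(M)` of `T^*Q ⊕ TQ`. -/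
theorem range_j : Set.range (j i) = pr₂ ⁻¹' (Set.range i) := by
  ext z
  constructor
  · rintro ⟨w, rfl⟩
    exact ⟨w.1, rfl⟩
  · rcases z with ⟨x, α, v⟩
    rintro ⟨m, hm⟩
    replace hm : i m = ⟨x, v⟩ := hm
    generalize hu : i m = u at hm
    subst hm
    have h1 : x = (i m).1 := by rw [hu]
    subst h1
    refine ⟨⟨m, α⟩, ?_⟩
    have h2 : (i m).2 = v := by
      have := hu
      rw [TotalSpace.ext_iff] at this
      exact eq_of_heq this.2
    subst h2
    rfl

theorem j_injective (hi : Function.Injective i) : Function.Injective (j i) := by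
  rintro ⟨m, α⟩ ⟨m', α'⟩ h
  have h' : i m = i m' := congrArg pr₂ h
  obtain rfl := hi h'
  have h2 := eq_of_heq (TotalSpace.ext_iff.1 h).2
  have h3 : α = α' := congrArg Prod.fst h2
  rw [h3]

/-- The presymplectic form `ω = π₁^* ω_Q` on `W₀`. -/
def omega : DiffForm (IW₀ E E') (W₀ i) 2 := pullback (IW₀ E E') (IC E) (π₁ i) (omegaQ E Q)

variable (L : TB E Q → ℝ)

/-- The restriction `L̃ : M → ℝ` of `L` to `M`. -/
def Lres (m : M) : ℝ := L (i m)

/-- The function `H_{W₀} = ⟨π₁, π₂⟩ - π₂^* L̃` on `W₀`. -/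
def HW₀ (w : W₀ i) : ℝ := ((π₁ i w).2 (i (π₂ i w)).2 : ℝ) - Lres i L (π₂ i w)

/-- The presymplectic form `ω̄ = j^*(Ω + pr₂^* ω_L)` on `W₀`. -/
def omegaBar : DiffForm (IW₀ E E') (W₀ i) 2 :=
  pullback (IW₀ E E') (IW E) (j i) (Omega E Q + pullback (IW E) (IT E) pr₂ (omegaL L))

/-- The restriction `F|_{W₀} : (m, α) ↦ (m, α - Leg_L(i(m)))` of `F` to `W₀`. -/
def FW₀ : W₀ i ≃ W₀ i where
  toFun w := ⟨w.1, HSub.hSub (α := Cotan E (i w.1).1) (β := Cotan E (i w.1).1)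
    (γ := Cotan E (i w.1).1) w.2 (legendre L (i w.1))⟩
  invFun w := ⟨w.1, HAdd.hAdd (α := Cotan E (i w.1).1) (β := Cotan E (i w.1).1)
    (γ := Cotan E (i w.1).1) w.2 (legendre L (i w.1))⟩
  left_inv w := congrArg (fun α : Cotan E (i w.1).1 => (⟨w.1, α⟩ : W₀ i))
    (sub_add_cancel (G := Cotan E (i w.1).1) w.2 (legendre L (i w.1)))
  right_inv w := congrArg (fun α : Cotan E (i w.1).1 => (⟨w.1, α⟩ : W₀ i))
    (add_sub_cancel_right (G := Cotan E (i w.1).1) w.2 (legendre L (i w.1)))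

theorem j_FW₀ (w : W₀ i) : j i (FW₀ i L w) = F L (j i w) := rfl

end Constrained

end Vakonomic

end

/-! The map `F` translates each momentum by `-Leg_L` over an unchanged point of `M`. The Liouville
form is tautological: its pullback by a map to `T^*Q` pairs the momentum with the derivative of the
base map, so it is additive in the momentum once the base map is fixed. Hence `(π₁ ∘ F)^*θ = π₁^*θ -
(Leg_L ∘ i ∘ π₂)^*θ` (`pullback_FW₀_liouville`).

Also `Leg_L^*θ = S^*dL` (`pullback_legendreMap_liouville`). Applying `-d`, which commutes with
pullback (`extD_pullback`), gives `F^*π₁^*ω_Q = ω - (i ∘ π₂)^*ω_L`. As `π₂ ∘ F = π₂`, the second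
term of `ω̄` cancels the defect and `F^*ω̄ = ω` (`pullback_FW₀_omegaBar`).

The Legendre terms also cancel in the Hamiltonians, so `H̄ ∘ j ∘ F = H_{W₀}`. Thus `F` carries the
data of (1) to those of (2), and a diffeomorphism transports solutions pointwise
(`IsSolutionAt.map_diffeomorph`); nondegeneracy plays no role. -/

noncomputable section

namespace Vakonomic

/-! ### Exterior derivative and pullback on manifolds -/

section Naturality

variable {V H N : Type*} [NormedAddCommGroup V] [NormedSpace ℝ V] [TopologicalSpace H]
  (I : ModelWithCorners ℝ V H) [TopologicalSpace N] [ChartedSpace H N]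
  {V' H' N' : Type*} [NormedAddCommGroup V'] [NormedSpace ℝ V'] [TopologicalSpace H']
  (I' : ModelWithCorners ℝ V' H') [TopologicalSpace N'] [ChartedSpace H' N']

/-- The local representative of a differential form in the preferred chart at `x`. -/
def localRep {k : ℕ} (σ : DiffForm I N k) (x : N) (y : V) : V [⋀^Fin k]→L[ℝ] ℝ :=
  (σ ((extChartAt I x).symm y)).compContinuousLinearMap
    (mfderiv 𝓘(ℝ, V) I (extChartAt I x).symm y)

/-- The local representatives of the form are differentiable at the base point of the chart. -/
def DiffFormDifferentiable {k : ℕ} (σ : DiffForm I N k) : Prop :=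
  ∀ x : N, DifferentiableAt ℝ (localRep I σ x) (extChartAt I x x)

variable {I I'}

theorem extD_eq [I.Boundaryless] {k : ℕ} (σ : DiffForm I N k) (x : N) :
    extD I σ x = (extDeriv (localRep I σ x) (extChartAt I x x)).compContinuousLinearMap
      (mfderiv I 𝓘(ℝ, V) (extChartAt I x) x) := by
  rw [← extDerivWithin_univ]
  simp only [extD, I.range_eq_univ, mfderivWithin_univ]
  rfl

theorem extD_sub [I.Boundaryless] {k : ℕ} {σ τ : DiffForm I N k}
    (hσ : DiffFormDifferentiable I σ) (hτ : DiffFormDifferentiable I τ) :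
    extD I (σ - τ) = extD I σ - extD I τ := by
  funext x
  have h : localRep I (σ - τ) x = localRep I σ x + (-1 : ℝ) • localRep I τ x := by
    rw [neg_one_smul ℝ (localRep I τ x), ← sub_eq_add_neg]
    rfl
  rw [extD_eq, Pi.sub_apply, extD_eq, extD_eq, h, extDeriv_add (hσ x) ((hτ x).const_smul _),
    extDeriv_smul, neg_one_smul ℝ (extDeriv (localRep I τ x) _), ← sub_eq_add_neg]
  rfl

/-- The tangent spaces at `z` and `z'` are distinct types that both unfold to `V'`; comparing `A`
and `B` there avoids casts. -/
theorem form_congr {k : ℕ} (σ : DiffForm I' N' k) {z z' : N'} (h : z = z')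
    (A : V →L[ℝ] TangentSpace I' z) (B : V →L[ℝ] TangentSpace I' z')
    (hAB : (A : V →L[ℝ] V') = B) :
    (σ z).compContinuousLinearMap A = (σ z').compContinuousLinearMap B := by
  subst h
  exact congrArg _ hAB

theorem pullback_comp {V'' H'' N'' : Type*} [NormedAddCommGroup V''] [NormedSpace ℝ V'']
    [TopologicalSpace H''] {I'' : ModelWithCorners ℝ V'' H''} [TopologicalSpace N'']
    [ChartedSpace H'' N''] {k : ℕ} {f : N → N'} {g : N' → N''} (σ : DiffForm I'' N'' k)
    (hf : MDifferentiable I I' f) (hg : MDifferentiable I' I'' g) :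
    pullback I I' f (pullback I' I'' g σ) = pullback I I'' (g ∘ f) σ := by
  funext x
  simp only [pullback, mfderiv_comp x (hg (f x)) (hf x)]
  rfl

theorem pullback_add {k : ℕ} (f : N → N') (σ τ : DiffForm I' N' k) :
    pullback I I' f (σ + τ) = pullback I I' f σ + pullback I I' f τ := rfl

theorem pullback_neg {k : ℕ} (f : N → N') (σ : DiffForm I' N' k) :
    pullback I I' f (-σ) = -pullback I I' f σ := rfl

/-- Chain rule applied to both sides of `f ∘ φ⁻¹ = ψ⁻¹ ∘ g`, where `φ`, `ψ` are the charts at `x`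
and `f x`, and `g` is `f` written in them. -/
theorem localRep_pullback [I.Boundaryless] [I'.Boundaryless] [IsManifold I ∞ N]
    [IsManifold I' ∞ N'] {k : ℕ} {f : N → N'} (hf : ContMDiff I I' ∞ f) (σ : DiffForm I' N' k)
    (x : N) :
    localRep I (pullback I I' f σ) x =ᶠ[𝓝 (extChartAt I x x)]
      fun y => (localRep I' σ (f x) (writtenInExtChartAt I I' x f y)).compContinuousLinearMap
        (fderiv ℝ (writtenInExtChartAt I I' x f) y) := by
  have hc : ContinuousAt (fun y => f ((extChartAt I x).symm y)) (extChartAt I x x) := by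
    refine ContinuousAt.comp ?_ (continuousAt_extChartAt_symm x)
    exact hf.continuous.continuousAt
  have hs : ∀ᶠ y in 𝓝 (extChartAt I x x),
      f ((extChartAt I x).symm y) ∈ (extChartAt I' (f x)).source := by
    refine hc.eventually_mem ?_
    simpa using extChartAt_source_mem_nhds (I := I') (f x)
  -- Derivatives at `y` will be compared, so each condition must hold on a neighbourhood of `y`.
  filter_upwards [hs.eventually_nhds,
    eventually_eventually_nhds.2 (extChartAt_target_mem_nhds (I := I) x)]
    with y hy hyt
  have hy0 := hy.self_of_nhds
  have hyt0 : y ∈ (extChartAt I x).target := mem_of_mem_nhds hyt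
  set g := writtenInExtChartAt I I' x f with hg
  have hgy : (extChartAt I' (f x)).symm (g y) = f ((extChartAt I x).symm y) := by
    simp only [hg, writtenInExtChartAt, Function.comp]
    exact (extChartAt I' (f x)).left_inv hy0
  have hgt : g y ∈ (extChartAt I' (f x)).target := (extChartAt I' (f x)).map_source hy0
  have d1 : MDifferentiableAt 𝓘(ℝ, V) I (extChartAt I x).symm y :=
    ((contMDiffOn_extChartAt_symm (n := ∞) x).contMDiffAt hyt).mdifferentiableAt (by simp)
  have d2 : MDifferentiableAt I I' f ((extChartAt I x).symm y) :=
    (hf _).mdifferentiableAt (by simp)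
  have d3 : MDifferentiableAt 𝓘(ℝ, V') I' (extChartAt I' (f x)).symm (g y) :=
    ((contMDiffOn_extChartAt_symm (n := ∞) (f x)).contMDiffAt
      ((isOpen_extChartAt_target (f x)).mem_nhds hgt)).mdifferentiableAt (by simp)
  have d4 : MDifferentiableAt I' 𝓘(ℝ, V') (extChartAt I' (f x)) (f ((extChartAt I x).symm y)) :=
    mdifferentiableAt_extChartAt (by simpa using hy0)
  have d5 : MDifferentiableAt 𝓘(ℝ, V) 𝓘(ℝ, V') g y := d4.comp y (d2.comp y d1)
  have e1 := mfderiv_comp y d2 d1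
  have e2 := mfderiv_comp y d3 d5
  have e3 : mfderiv 𝓘(ℝ, V) I' (f ∘ (extChartAt I x).symm) y =
      mfderiv 𝓘(ℝ, V) I' ((extChartAt I' (f x)).symm ∘ g) y := by
    refine Filter.EventuallyEq.mfderiv_eq ?_
    filter_upwards [hy] with z hz
    simp only [hg, writtenInExtChartAt, Function.comp]
    exact ((extChartAt I' (f x)).left_inv hz).symm
  rw [e1, e2] at e3
  have e4 := mfderiv_eq_fderiv (𝕜 := ℝ) (E := V) (E' := V') (f := g) (x := y)
  exact form_congr (V := V) σ hgy.symm _ _ (e3.trans (congrArg (fun A : V →L[ℝ] V' =>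
    ContinuousLinearMap.comp (mfderiv 𝓘(ℝ, V') I' (extChartAt I' (f x)).symm (g y) :
      V' →L[ℝ] V') A) e4))

theorem contDiffAt_writtenInExtChartAt [I.Boundaryless] {f : N → N'}
    (hf : ContMDiff I I' ∞ f) (x : N) :
    ContDiffAt ℝ ∞ (writtenInExtChartAt I I' x f) (extChartAt I x x) := by
  have := ((contMDiffAt_iff).1 (hf x)).2
  rwa [I.range_eq_univ, contDiffWithinAt_univ] at this

theorem writtenInExtChartAt_self (f : N → N') (x : N) :
    writtenInExtChartAt I I' x f (extChartAt I x x) = extChartAt I' (f x) (f x) := by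
  simp [writtenInExtChartAt]

theorem DiffFormDifferentiable.pullback [I.Boundaryless] [I'.Boundaryless] [IsManifold I ∞ N]
    [IsManifold I' ∞ N'] {k : ℕ} {f : N → N'} {σ : DiffForm I' N' k}
    (hσ : DiffFormDifferentiable I' σ) (hf : ContMDiff I I' ∞ f) :
    DiffFormDifferentiable I (pullback I I' f σ) := by
  intro x
  refine DifferentiableAt.congr_of_eventuallyEq ?_ (localRep_pullback hf σ x)
  have hg := contDiffAt_writtenInExtChartAt hf x
  have h1 := hσ (f x)
  rw [← writtenInExtChartAt_self (I := I)] at h1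
  have h2 := h1.comp _ (hg.differentiableAt (by simp))
  have h3 : DifferentiableAt ℝ (fderiv ℝ (writtenInExtChartAt I I' x f)) (extChartAt I x x) :=
    (hg.fderiv_right (m := 1) (by norm_num; exact ENat.LEInfty.out)).differentiableAt (by simp)
  exact h2.continuousAlternatingMapCompContinuousLinearMap h3

/-- In charts this is naturality of `d` between normed spaces; the outer chart differentials then
match because `g ∘ φ = ψ ∘ f` near `x`. -/
theorem extD_pullback [I.Boundaryless] [I'.Boundaryless] [IsManifold I ∞ N]
    [IsManifold I' ∞ N'] {k : ℕ} {f : N → N'} {σ : DiffForm I' N' k}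
    (hσ : DiffFormDifferentiable I' σ) (hf : ContMDiff I I' ∞ f) :
    extD I (pullback I I' f σ) = pullback I I' f (extD I' σ) := by
  funext x
  have hg := contDiffAt_writtenInExtChartAt hf x
  have h1 := hσ (f x)
  rw [← writtenInExtChartAt_self (I := I)] at h1
  have d1 : MDifferentiableAt I 𝓘(ℝ, V) (extChartAt I x) x :=
    mdifferentiableAt_extChartAt (by simp)
  have d2 : MDifferentiableAt I I' f x := (hf _).mdifferentiableAt (by simp)
  have d4 : MDifferentiableAt I' 𝓘(ℝ, V') (extChartAt I' (f x)) (f x) :=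
    mdifferentiableAt_extChartAt (by simp)
  have d5 : MDifferentiableAt 𝓘(ℝ, V) 𝓘(ℝ, V') (writtenInExtChartAt I I' x f)
      (extChartAt I x x) :=
    (hg.differentiableAt (by simp)).mdifferentiableAt
  have e1 := mfderiv_comp x d4 d2
  have e2 := mfderiv_comp x d5 d1
  have e3 : mfderiv I 𝓘(ℝ, V') (writtenInExtChartAt I I' x f ∘ extChartAt I x) x =
      mfderiv I 𝓘(ℝ, V') (extChartAt I' (f x) ∘ f) x := by
    refine Filter.EventuallyEq.mfderiv_eq ?_
    filter_upwards [extChartAt_source_mem_nhds (I := I) x] with z hz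
    simp only [writtenInExtChartAt, Function.comp, (extChartAt I x).left_inv hz]
  rw [e1, e2, mfderiv_eq_fderiv] at e3
  rw [extD_eq, (localRep_pullback hf σ x).extDeriv_eq,
    extDeriv_pullback h1 hg (by rw [minSmoothness_of_isRCLikeNormedField]; exact ENat.LEInfty.out),
    Vakonomic.pullback, extD_eq,
    writtenInExtChartAt_self]
  exact congrArg (fun A => (extDeriv (localRep I' σ (f x))
    (extChartAt I' (f x) (f x))).compContinuousLinearMap A) e3

end Naturality

/-! ### Smooth maps between the bundles and the Legendre transformation -/

section Ambient

variable {E : Type*} [NormedAddCommGroup E] [NormedSpace ℝ E]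
  {Q : Type*} [TopologicalSpace Q] [ChartedSpace E Q] [IsManifold 𝓘(ℝ, E) ∞ Q]
  {V H N : Type*} [NormedAddCommGroup V] [NormedSpace ℝ V] [TopologicalSpace H]
  {I : ModelWithCorners ℝ V H} [TopologicalSpace N] [ChartedSpace H N]

theorem contMDiff_pr₁ : ContMDiff (IW E) (IC E) ∞ (pr₁ : WB E Q → CB E Q) := by
  intro z
  have h := (contMDiffAt_totalSpace (IB := 𝓘(ℝ, E))).1
    (contMDiffAt_id (I := IW E) (n := ∞) (x := z))
  exact contMDiffAt_totalSpace.2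
    ⟨h.1, ((contDiff_fst (n := ∞)).contMDiff.contMDiffAt).comp z h.2⟩

theorem contMDiff_pr₂ : ContMDiff (IW E) (IT E) ∞ (pr₂ : WB E Q → TB E Q) := by
  intro z
  have h := (contMDiffAt_totalSpace (IB := 𝓘(ℝ, E))).1
    (contMDiffAt_id (I := IW E) (n := ∞) (x := z))
  refine contMDiffAt_totalSpace.2 ⟨h.1, ?_⟩
  exact ((contDiff_snd (𝕜 := ℝ) (E := E →L[ℝ] ℝ) (F := E) (n := ∞)).contMDiff.contMDiffAt).comp
    z h.2

theorem contMDiff_whitneySum {f : N → WB E Q} (h₁ : ContMDiff I (IC E) ∞ (fun x => pr₁ (f x)))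
    (h₂ : ContMDiff I (IT E) ∞ (fun x => pr₂ (f x))) : ContMDiff I (IW E) ∞ f := by
  intro x
  have h₁ := contMDiffAt_totalSpace.1 (h₁ x)
  have h₂ := contMDiffAt_totalSpace.1 (h₂ x)
  exact contMDiffAt_totalSpace.2 ⟨h₁.1, h₁.2.prodMk_space h₂.2⟩

theorem contMDiff_fibreInclusion (x : Q) :
    ContMDiff 𝓘(ℝ, E) (IT E) ∞ (fun w : E => (⟨x, w⟩ : TB E Q)) := by
  intro w
  refine contMDiffAt_totalSpace.2 ⟨contMDiffAt_const, ?_⟩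
  let A : E →L[ℝ] E :=
    (trivializationAt E (TangentSpace 𝓘(ℝ, E) : Q → Type _) x).continuousLinearMapAt ℝ x
  have h : ContDiff ℝ ∞ A := A.contDiff
  refine (h.contMDiff w).congr_of_eventuallyEq (Filter.Eventually.of_forall fun u => ?_)
  exact (congrFun (Bundle.Trivialization.coe_linearMapAt_of_mem _
    (mem_baseSet_trivializationAt E (TangentSpace 𝓘(ℝ, E)) x)) u).symm

/-- The cotangent trivialization is the transpose of the inverse tangent one. No base set condition
is needed. -/
theorem trivializationAt_cotangent_apply (x₀ : Q) (α : CB E Q) (w : E) :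
    (trivializationAt (E →L[ℝ] ℝ) (fun x : Q => Cotan E x) x₀ α).2 w =
      α.2 ((trivializationAt E (TangentSpace 𝓘(ℝ, E) : Q → Type _) x₀).symmL ℝ α.1 w) := by
  rw [hom_trivializationAt_apply]
  change (((Bundle.Trivial.trivialization Q ℝ).continuousLinearMapAt ℝ α.1).comp _) w = _
  rw [Bundle.Trivial.continuousLinearMapAt_trivialization]
  rfl

/-- The Legendre transformation as a map `TQ → T^*Q`. -/
def legendreMap (L : TB E Q → ℝ) (v : TB E Q) : CB E Q := ⟨v.1, legendre L v⟩

/-- In bundle charts the momentum of `Leg_L` is the partial derivative of the local expression `ℓ`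
of `L` in the fibre variable, which is smooth. -/
theorem contMDiff_legendreMap {L : TB E Q → ℝ} (hL : ContMDiff (IT E) 𝓘(ℝ, ℝ) ∞ L) :
    ContMDiff (IT E) (IC E) ∞ (legendreMap L) := by
  intro v₀
  refine contMDiffAt_totalSpace.2 ⟨contMDiff_proj _ v₀, ?_⟩
  set e := trivializationAt E (TangentSpace 𝓘(ℝ, E) : Q → Type _) v₀.1 with he
  set ℓ : E × E → ℝ := L ∘ (extChartAt (IT E) v₀).symm with hℓ
  have hφ : ∀ᶠ v in 𝓝 v₀, v ∈ (extChartAt (IT E) v₀).source :=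
    extChartAt_source_mem_nhds v₀
  have hℓs : ∀ v ∈ (extChartAt (IT E) v₀).source, ContDiffAt ℝ ∞ ℓ (extChartAt (IT E) v₀ v) := by
    intro v hv
    rw [← contMDiffAt_iff_contDiffAt]
    refine (hL _).comp _ ((contMDiffOn_extChartAt_symm v₀).contMDiffAt ?_)
    exact (isOpen_extChartAt_target v₀).mem_nhds ((extChartAt (IT E) v₀).map_source hv)
  have h1 : ContMDiffAt (IT E) 𝓘(ℝ, E →L[ℝ] ℝ) ∞ (fun v =>
      (fderiv ℝ ℓ (extChartAt (IT E) v₀ v)).comp (ContinuousLinearMap.inr ℝ E E)) v₀ := by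
    have h2 : ContDiffAt ℝ ∞ (fun y => (fderiv ℝ ℓ y).comp (ContinuousLinearMap.inr ℝ E E))
        (extChartAt (IT E) v₀ v₀) :=
      (((hℓs v₀ (mem_extChartAt_source v₀)).fderiv_right (m := ∞) (by simp))).clm_comp
        contDiffAt_const
    exact h2.contMDiffAt.comp v₀ contMDiffAt_extChartAt
  refine h1.congr_of_eventuallyEq ?_
  filter_upwards [hφ] with v hv
  have hb : v.1 ∈ e.baseSet := by
    rw [FiberBundle.extChartAt] at hv
    exact e.mem_source.1 hv.1
  have hc : v.1 ∈ (extChartAt 𝓘(ℝ, E) v₀.1).source := by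
    simpa [he] using hb
  -- The inverse chart is linear along each fibre.
  have key : ∀ ξ : E, (extChartAt (IT E) v₀).symm (extChartAt 𝓘(ℝ, E) v₀.1 v.1, ξ) =
      ⟨v.1, e.symmL ℝ v.1 ξ⟩ := by
    intro ξ
    rw [FiberBundle.extChartAt]
    change e.toOpenPartialHomeomorph.symm
      ((extChartAt 𝓘(ℝ, E) v₀.1).symm (extChartAt 𝓘(ℝ, E) v₀.1 v.1), ξ) = _
    rw [(extChartAt 𝓘(ℝ, E) v₀.1).left_inv hc]
    rw [e.symmL_apply]
    · exact (e.mk_symm hb ξ).symm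
    · exact hb
  have hv2 : extChartAt (IT E) v₀ v = (extChartAt 𝓘(ℝ, E) v₀.1 v.1, (e v).2) := by
    rw [FiberBundle.extChartAt]
    exact congrArg (fun q => (extChartAt 𝓘(ℝ, E) v₀.1 q, (e v).2)) (e.coe_fst' hb)
  have hs : ∀ w : E, e.symmL ℝ v.1 (e.continuousLinearMapAt ℝ v.1 w) = w :=
    fun w => e.symmL_continuousLinearMapAt hb w
  have d1 : DifferentiableAt ℝ (fun w : E => L ⟨v.1, w⟩) v.2 :=
    ((hL.comp (contMDiff_fibreInclusion v.1)).contDiff.differentiable (by simp)) _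
  have d2 : HasFDerivAt (fun ξ : E => ℓ (extChartAt 𝓘(ℝ, E) v₀.1 v.1, ξ))
      ((fderiv ℝ ℓ (extChartAt (IT E) v₀ v)).comp (ContinuousLinearMap.inr ℝ E E)) (e v).2 := by
    have := ((hℓs v hv).differentiableAt (by simp)).hasFDerivAt
    rw [hv2] at this ⊢
    exact this.comp (e v).2 (hasFDerivAt_prodMk_right _ _)
  have e2 : (e.symmL ℝ v.1 : E →L[ℝ] E) (e v).2 = v.2 := by
    rw [← hs v.2, Bundle.Trivialization.continuousLinearMapAt_apply,
      Bundle.Trivialization.coe_linearMapAt_of_mem _ hb]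
  -- The same fibre derivative computed through `L` itself; uniqueness of derivatives identifies it
  -- with `d2`.
  have d3 : HasFDerivAt (fun ξ : E => ℓ (extChartAt 𝓘(ℝ, E) v₀.1 v.1, ξ))
      ((fderiv ℝ (fun w : E => L ⟨v.1, w⟩) v.2).comp (e.symmL ℝ v.1 : E →L[ℝ] E)) (e v).2 := by
    have h3 : (fun ξ : E => ℓ (extChartAt 𝓘(ℝ, E) v₀.1 v.1, ξ)) =
        (fun w : E => L ⟨v.1, w⟩) ∘ (e.symmL ℝ v.1 : E →L[ℝ] E) := by
      funext ξ
      simp only [hℓ, Function.comp, key]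
    rw [h3]
    refine HasFDerivAt.comp _ ?_ (ContinuousLinearMap.hasFDerivAt _)
    rw [e2]
    exact d1.hasFDerivAt
  rw [d2.unique d3]
  ext w
  exact trivializationAt_cotangent_apply _ _ _

/-! ### The Liouville form and its pullbacks -/

/-- In the preferred charts, the Liouville form is `p_A dq^A`. -/
theorem localRep_liouville (α₀ : CB E Q) :
    localRep (IC E) (liouville E Q) α₀ =ᶠ[𝓝 (extChartAt (IC E) α₀ α₀)] fun y =>
      ContinuousAlternatingMap.ofSubsingleton ℝ (E × (E →L[ℝ] ℝ)) ℝ (0 : Fin 1)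
        (y.2.comp (ContinuousLinearMap.fst ℝ E (E →L[ℝ] ℝ))) := by
  filter_upwards [eventually_eventually_nhds.2 (extChartAt_target_mem_nhds (I := IC E) α₀)]
    with y hy
  have hy0 : y ∈ (extChartAt (IC E) α₀).target := mem_of_mem_nhds hy
  set α := (extChartAt (IC E) α₀).symm y with hα
  have hs : α ∈ (extChartAt (IC E) α₀).source := (extChartAt (IC E) α₀).map_target hy0
  have hb : α.1 ∈ (chartAt E α₀.1).source := by
    rw [FiberBundle.extChartAt] at hs
    have := (Bundle.Trivialization.mem_source _).1 hs.1
    simpa using this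
  have hya : extChartAt (IC E) α₀ α = y := (extChartAt (IC E) α₀).right_inv hy0
  have hy1 : extChartAt 𝓘(ℝ, E) α₀.1 α.1 = y.1 := by
    rw [← hya, FiberBundle.extChartAt]
    rfl
  have hy2 : ∀ w : E, y.2 w =
      α.2 ((trivializationAt E (TangentSpace 𝓘(ℝ, E) : Q → Type _) α₀.1).symmL ℝ α.1 w) := by
    intro w
    rw [← trivializationAt_cotangent_apply, ← hya, FiberBundle.extChartAt]
    rfl
  have d1 : MDifferentiableAt 𝓘(ℝ, E × (E →L[ℝ] ℝ)) (IC E) (extChartAt (IC E) α₀).symm y :=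
    ((contMDiffOn_extChartAt_symm (n := ∞) α₀).contMDiffAt hy).mdifferentiableAt (by simp)
  have d2 : MDifferentiableAt (IC E) 𝓘(ℝ, E) (TotalSpace.proj : CB E Q → Q) α :=
    ((contMDiff_proj (n := ∞) (fun x : Q => Cotan E x)) α).mdifferentiableAt (by simp)
  have d3 : MDifferentiableAt 𝓘(ℝ, E) 𝓘(ℝ, E) (extChartAt 𝓘(ℝ, E) α₀.1).symm y.1 := by
    have hm : y.1 ∈ (extChartAt 𝓘(ℝ, E) α₀.1).target := by
      rw [← hy1]
      exact (extChartAt 𝓘(ℝ, E) α₀.1).map_source (by simpa using hb)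
    exact ((contMDiffOn_extChartAt_symm (n := ∞) α₀.1).contMDiffAt
      ((isOpen_extChartAt_target α₀.1).mem_nhds hm)).mdifferentiableAt (by simp)
  have d4 : HasMFDerivAt 𝓘(ℝ, E × (E →L[ℝ] ℝ)) 𝓘(ℝ, E) (Prod.fst : E × (E →L[ℝ] ℝ) → E) y
      (ContinuousLinearMap.fst ℝ E (E →L[ℝ] ℝ)) :=
    hasFDerivAt_fst.hasMFDerivAt
  have e1 := mfderiv_comp y d2 d1
  have e2 : mfderiv 𝓘(ℝ, E × (E →L[ℝ] ℝ)) 𝓘(ℝ, E)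
      ((TotalSpace.proj : CB E Q → Q) ∘ (extChartAt (IC E) α₀).symm) y =
      mfderiv 𝓘(ℝ, E × (E →L[ℝ] ℝ)) 𝓘(ℝ, E) ((extChartAt 𝓘(ℝ, E) α₀.1).symm ∘ Prod.fst) y := by
    refine Filter.EventuallyEq.mfderiv_eq ?_
    filter_upwards [hy] with z hz
    rw [extChartAt_target] at hz
    exact FiberBundle.chartedSpace_chartAt_symm_fst α₀ z hz.1
  rw [(d3.hasMFDerivAt.comp y d4).mfderiv, e1] at e2
  -- The inverse tangent trivialization is the derivative of the inverse base chart, so the momentum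
  -- coordinate `y.2` is `α` composed with that derivative.
  have e3 := TangentBundle.symmL_trivializationAt (I := 𝓘(ℝ, E)) (𝕜 := ℝ) hb
  rw [hy1, ModelWithCorners.range_eq_univ, mfderivWithin_univ] at e3
  ext u
  refine Eq.trans ?_ (hy2 (u 0).1).symm
  refine congrArg α.2 ?_
  rw [e3]
  exact congrArg (fun A : (E × (E →L[ℝ] ℝ)) →L[ℝ] E => A (u 0)) e2

theorem differentiable_ofSubsingleton {A : V → V →L[ℝ] ℝ} (hA : Differentiable ℝ A) :
    Differentiable ℝ fun y =>
      (ContinuousAlternatingMap.ofSubsingleton ℝ V ℝ (0 : Fin 1) (A y) : V [⋀^Fin 1]→L[ℝ] ℝ) :=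
  (ContinuousAlternatingMap.ofSubsingletonLIE (𝕜 := ℝ) (E := V) (F := ℝ)
    (0 : Fin 1)).differentiable.comp hA

theorem differentiable_liouville : DiffFormDifferentiable (IC E) (liouville E Q) := by
  intro α₀
  refine DifferentiableAt.congr_of_eventuallyEq ?_ (localRep_liouville α₀)
  refine differentiable_ofSubsingleton ?_ _
  exact differentiable_snd.clm_comp (differentiable_const _)

/-- Chain rule for the bundle projection: only the base component of `f` is differentiated, and its
momentum enters linearly. -/
theorem pullback_liouville {f : N → CB E Q} (hf : ContMDiff I (IC E) ∞ f)
    (x : N) (u : Fin 1 → TangentSpace I x) :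
    pullback I (IC E) f (liouville E Q) x u =
      (f x).2 (mfderiv I 𝓘(ℝ, E) (fun y => (f y).1) x (u 0)) := by
  have d1 : MDifferentiableAt I (IC E) f x := (hf x).mdifferentiableAt (by simp)
  have d2 : MDifferentiableAt (IC E) 𝓘(ℝ, E) (TotalSpace.proj : CB E Q → Q) (f x) :=
    ((contMDiff_proj (n := ∞) (fun x : Q => Cotan E x)) _).mdifferentiableAt (by simp)
  have e1 := mfderiv_comp x d2 d1
  exact congrArg (f x).2 (congrArg (fun A : TangentSpace I x →L[ℝ] E => A (u 0)) e1.symm)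

/-- The `1`-form `S^* dL` is the pullback of the Liouville form by the Legendre transformation. -/
theorem pullback_legendreMap_liouville {L : TB E Q → ℝ} (hL : ContMDiff (IT E) 𝓘(ℝ, ℝ) ∞ L) :
    pullback (IT E) (IC E) (legendreMap L) (liouville E Q) =
      oneForm (IT E) fun u =>
        ((mfderiv (IT E) 𝓘(ℝ, ℝ) L u).comp (vertEndo u) :
          TangentSpace (IT E) u →L[ℝ] ℝ) := by
  funext v
  ext u
  rw [pullback_liouville (contMDiff_legendreMap hL)]
  have d1 : MDifferentiableAt (IT E) 𝓘(ℝ, ℝ) L v := (hL v).mdifferentiableAt (by simp)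
  have d2 : MDifferentiableAt 𝓘(ℝ, E) (IT E) (fun w : E => (⟨v.1, w⟩ : TB E Q)) v.2 :=
    (contMDiff_fibreInclusion v.1 _).mdifferentiableAt (by simp)
  -- Along a fibre, `dL` composed with the vertical lift is the fibre derivative `Leg_L`.
  have e1 := mfderiv_comp (I := 𝓘(ℝ, E)) (I' := IT E) (I'' := 𝓘(ℝ, ℝ)) (g := L)
    (f := fun w : E => (⟨v.1, w⟩ : TB E Q)) v.2 d1 d2
  have e2 := mfderiv_eq_fderiv (𝕜 := ℝ) (E := E) (E' := ℝ) (f := fun w : E => L ⟨v.1, w⟩)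
    (x := v.2)
  exact congrArg (fun A : E →L[ℝ] ℝ =>
    A (mfderiv (IT E) 𝓘(ℝ, E) (TotalSpace.proj : TB E Q → Q) v (u 0))) (e2.symm.trans e1)

theorem omegaL_eq {L : TB E Q → ℝ} (hL : ContMDiff (IT E) 𝓘(ℝ, ℝ) ∞ L) :
    omegaL L = -extD (IT E) (pullback (IT E) (IC E) (legendreMap L) (liouville E Q)) := by
  rw [pullback_legendreMap_liouville hL]
  rfl

end Ambient

/-! ### Transport of solutions by a diffeomorphism -/

section Solutions

variable {V H N : Type*} [NormedAddCommGroup V] [NormedSpace ℝ V] [TopologicalSpace H]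
  {I : ModelWithCorners ℝ V H} [TopologicalSpace N] [ChartedSpace H N]
  {V' H' N' : Type*} [NormedAddCommGroup V'] [NormedSpace ℝ V'] [TopologicalSpace H']
  {I' : ModelWithCorners ℝ V' H'} [TopologicalSpace N'] [ChartedSpace H' N']

/-- A diffeomorphism maps solutions of the pulled back equation to solutions. -/
theorem IsSolutionAt.map_diffeomorph {Φ : N ≃ N'} (hΦ : MDifferentiable I I' Φ)
    (hΦs : MDifferentiable I' I Φ.symm) {σ : DiffForm I' N' 2} {f : N' → ℝ}
    (hf : MDifferentiable I' 𝓘(ℝ, ℝ) f) {x : N} {X : TangentSpace I x}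
    (h : IsSolutionAt I (pullback I I' Φ σ) (f ∘ Φ) x X) :
    IsSolutionAt I' σ f (Φ x) (mfderiv I I' Φ x X) := by
  intro Z
  have e0 : mfderiv I' I' (Φ ∘ Φ.symm) (Φ x) = ContinuousLinearMap.id ℝ _ := by
    rw [Φ.self_comp_symm]
    exact mfderiv_id
  have hx : Φ.symm (Φ x) = x := Φ.symm_apply_apply x
  -- The differential of `Φ` is onto because `Φ ∘ Φ⁻¹ = id`, so every test vector is an image.
  obtain ⟨W, rfl⟩ : ∃ W : TangentSpace I x, mfderiv I I' Φ x W = Z := by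
    have e1 := mfderiv_comp (Φ x) (hΦ (Φ.symm (Φ x))) (hΦs (Φ x))
    rw [e0] at e1
    -- `Φ.symm (Φ x)` equals `x` only propositionally; it is generalized to `y` so that it can be
    -- substituted.
    have e2 : ∀ (y : N) (_ : y = x) (B : TangentSpace I' (Φ x) →L[ℝ] TangentSpace I y)
        (_ : (ContinuousLinearMap.id ℝ V' : V' →L[ℝ] V') =
          ContinuousLinearMap.comp (mfderiv I I' Φ y : V →L[ℝ] V') (B : V' →L[ℝ] V)),
        ∃ W : TangentSpace I x, mfderiv I I' Φ x W = Z := by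
      rintro y rfl B hB
      exact ⟨B Z, (congrArg (fun A : V' →L[ℝ] V' => A Z) hB).symm⟩
    exact e2 _ hx _ e1
  have h1 := h W
  rw [mfderiv_comp x (hf (Φ x)) (hΦ x)] at h1
  refine Eq.trans ?_ h1
  refine congrArg (σ (Φ x)) ?_
  funext k
  fin_cases k <;> rfl

end Solutions

/-! ### The constrained phase space and the action of `F` on its data -/

section Constrained

variable {E : Type*} [NormedAddCommGroup E] [NormedSpace ℝ E]
  {Q : Type*} [TopologicalSpace Q] [ChartedSpace E Q] [IsManifold 𝓘(ℝ, E) ∞ Q]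
  {E' : Type*} [NormedAddCommGroup E'] [NormedSpace ℝ E']
  {M : Type*} [TopologicalSpace M] [ChartedSpace E' M]
  (i : C^∞⟮𝓘(ℝ, E'), M; IT E, TB E Q⟯)

theorem contMDiff_π₂ : ContMDiff (IW₀ E E') 𝓘(ℝ, E') ∞ (π₂ i) :=
  contMDiff_proj _

theorem contMDiff_comp_π₂ : ContMDiff (IW₀ E E') (IT E) ∞ (i ∘ π₂ i) :=
  i.contMDiff.comp (contMDiff_π₂ i)

theorem contMDiff_π₁ : ContMDiff (IW₀ E E') (IC E) ∞ (π₁ i) := by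
  intro w
  have h := (contMDiffAt_totalSpace (IB := 𝓘(ℝ, E'))).1
    (contMDiffAt_id (I := IW₀ E E') (n := ∞) (x := w))
  exact contMDiffAt_totalSpace.2 ⟨(base i).contMDiff.contMDiffAt.comp w h.1, h.2⟩

theorem contMDiff_j : ContMDiff (IW₀ E E') (IW E) ∞ (j i) :=
  contMDiff_whitneySum (contMDiff_π₁ i) (contMDiff_comp_π₂ i)

/-- The pulled back bundle inherits the trivializations of `T^*Q`, so the fibre coordinate of `f` is
that of `π₁ ∘ f`. -/
theorem contMDiff_W₀ {V H N : Type*} [NormedAddCommGroup V] [NormedSpace ℝ V]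
    [TopologicalSpace H] {I : ModelWithCorners ℝ V H} [TopologicalSpace N] [ChartedSpace H N]
    {f : N → W₀ i} (h₁ : ContMDiff I (IC E) ∞ (fun x => π₁ i (f x)))
    (h₂ : ContMDiff I 𝓘(ℝ, E') ∞ (fun x => π₂ i (f x))) : ContMDiff I (IW₀ E E') ∞ f := by
  intro x
  exact contMDiffAt_totalSpace.2 ⟨h₂ x, (contMDiffAt_totalSpace.1 (h₁ x)).2⟩

variable {L : TB E Q → ℝ}

theorem contMDiff_FW₀ (hL : ContMDiff (IT E) 𝓘(ℝ, ℝ) ∞ L) :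
    ContMDiff (IW₀ E E') (IW₀ E E') ∞ (FW₀ i L) := by
  refine contMDiff_W₀ i (fun w => ?_) (contMDiff_π₂ i)
  have h₁ := contMDiffAt_totalSpace.1 (contMDiff_π₁ i w)
  have h₂ := contMDiffAt_totalSpace.1 ((contMDiff_legendreMap hL).comp (contMDiff_comp_π₂ i) w)
  refine contMDiffAt_totalSpace.2 ⟨h₁.1, ?_⟩
  -- Over a common base point the trivialization is linear, so the coordinates subtract.
  refine (h₁.2.sub h₂.2).congr_of_eventuallyEq (Filter.Eventually.of_forall fun u => ?_)
  ext z
  refine (trivializationAt_cotangent_apply _ _ _).trans ?_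
  refine Eq.trans ?_ (congrArg₂ (· - ·) (trivializationAt_cotangent_apply _ _ _)
    (trivializationAt_cotangent_apply _ _ _)).symm
  rfl

theorem contMDiff_FW₀_symm (hL : ContMDiff (IT E) 𝓘(ℝ, ℝ) ∞ L) :
    ContMDiff (IW₀ E E') (IW₀ E E') ∞ (FW₀ i L).symm := by
  refine contMDiff_W₀ i (fun w => ?_) (contMDiff_π₂ i)
  have h₁ := contMDiffAt_totalSpace.1 (contMDiff_π₁ i w)
  have h₂ := contMDiffAt_totalSpace.1 ((contMDiff_legendreMap hL).comp (contMDiff_comp_π₂ i) w)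
  refine contMDiffAt_totalSpace.2 ⟨h₁.1, ?_⟩
  refine (h₁.2.add h₂.2).congr_of_eventuallyEq (Filter.Eventually.of_forall fun u => ?_)
  ext z
  refine (trivializationAt_cotangent_apply _ _ _).trans ?_
  refine Eq.trans ?_ (congrArg₂ (· + ·) (trivializationAt_cotangent_apply _ _ _)
    (trivializationAt_cotangent_apply _ _ _)).symm
  rfl

theorem contMDiff_HW₀ (hL : ContMDiff (IT E) 𝓘(ℝ, ℝ) ∞ L) :
    ContMDiff (IW₀ E E') 𝓘(ℝ, ℝ) ∞ (HW₀ i L) := by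
  refine ContMDiff.sub (fun w => ?_) (hL.comp (contMDiff_comp_π₂ i))
  have h := ContMDiffAt.clm_bundle_apply (F₁ := E) (F₂ := ℝ)
    (E₁ := (TangentSpace 𝓘(ℝ, E) : Q → Type _)) (E₂ := Bundle.Trivial Q ℝ)
    (b := fun w : W₀ i => (i w.1).1) (ϕ := fun w => w.2) (v := fun w => (i w.1).2)
    (contMDiff_π₁ i w) (contMDiff_comp_π₂ i w)
  exact (contMDiffAt_totalSpace.1 h).2

theorem Hbar_comp_j_FW₀ : (Hbar L ∘ j i) ∘ FW₀ i L = HW₀ i L := by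
  funext w
  let α : E →L[ℝ] ℝ := w.2
  let β : E →L[ℝ] ℝ := legendre L (i w.1)
  let v : E := (i w.1).2
  change (α v - β v) + (β v - L (i w.1)) = α v - L (i w.1)
  ring

/-- Read off from `H_{W₀} ∘ F⁻¹`, with no separate smoothness argument for the energy. -/
theorem contMDiff_Hbar_comp_j (hL : ContMDiff (IT E) 𝓘(ℝ, ℝ) ∞ L) :
    ContMDiff (IW₀ E E') 𝓘(ℝ, ℝ) ∞ (Hbar L ∘ j i) := by
  have h := (contMDiff_HW₀ i hL).comp (contMDiff_FW₀_symm i hL)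
  rwa [← Hbar_comp_j_FW₀, Function.comp_assoc, Equiv.self_comp_symm, Function.comp_id] at h

theorem omegaBar_eq : omegaBar i L = omega i +
    pullback (IW₀ E E') (IT E) (i ∘ π₂ i) (omegaL L) := by
  have hj := (contMDiff_j i).mdifferentiable (by simp)
  rw [omegaBar, pullback_add, Omega,
    pullback_comp _ hj (contMDiff_pr₁.mdifferentiable (by simp)),
    pullback_comp _ hj (contMDiff_pr₂.mdifferentiable (by simp))]
  rfl

/-- All three maps to `T^*Q` have base component `τ_Q ∘ i ∘ π₂`, so only the momenta are subtracted.
-/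
theorem pullback_FW₀_liouville (hL : ContMDiff (IT E) 𝓘(ℝ, ℝ) ∞ L) :
    pullback (IW₀ E E') (IC E) (π₁ i ∘ FW₀ i L) (liouville E Q) =
      pullback (IW₀ E E') (IC E) (π₁ i) (liouville E Q) -
        pullback (IW₀ E E') (IC E) (legendreMap L ∘ i ∘ π₂ i) (liouville E Q) := by
  funext w
  ext u
  refine (pullback_liouville ((contMDiff_π₁ i).comp (contMDiff_FW₀ i hL)) w u).trans ?_
  exact (congrArg₂ (· - ·) (pullback_liouville (contMDiff_π₁ i) w u)
    (pullback_liouville ((contMDiff_legendreMap hL).comp (contMDiff_comp_π₂ i)) w u)).symm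

variable [IsManifold 𝓘(ℝ, E') ∞ M]

theorem pullback_FW₀_omegaBar (hL : ContMDiff (IT E) 𝓘(ℝ, ℝ) ∞ L) :
    pullback (IW₀ E E') (IW₀ E E') (FW₀ i L) (omegaBar i L) = omega i := by
  have hF := (contMDiff_FW₀ i hL).mdifferentiable (by simp)
  have hθ := differentiable_liouville (E := E) (Q := Q)
  have hl := contMDiff_legendreMap hL
  have h2 := contMDiff_comp_π₂ i
  have hω : ∀ f : W₀ i → CB E Q, ContMDiff (IW₀ E E') (IC E) ∞ f →
      pullback (IW₀ E E') (IC E) f (omegaQ E Q) =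
        -extD (IW₀ E E') (pullback (IW₀ E E') (IC E) f (liouville E Q)) := by
    intro f hf
    rw [extD_pullback hθ hf]
    rfl
  have hωL : pullback (IW₀ E E') (IT E) (i ∘ π₂ i) (omegaL L) =
      -extD (IW₀ E E') (pullback (IW₀ E E') (IC E) (legendreMap L ∘ i ∘ π₂ i)
        (liouville E Q)) := by
    rw [omegaL_eq hL, pullback_neg, ← extD_pullback (hθ.pullback hl) h2,
      pullback_comp _ (h2.mdifferentiable (by simp)) (hl.mdifferentiable (by simp))]
  rw [omegaBar_eq, pullback_add, omega,
    pullback_comp _ hF ((contMDiff_π₁ i).mdifferentiable (by simp)),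
    pullback_comp _ hF (h2.mdifferentiable (by simp))]
  -- `F` fixes the `M` component, so `i ∘ π₂ ∘ F` is `i ∘ π₂` by definition.
  change _ + pullback (IW₀ E E') (IT E) (i ∘ π₂ i) (omegaL L) = _
  rw [hωL, hω _ (contMDiff_π₁ i), hω _ ((contMDiff_π₁ i).comp (contMDiff_FW₀ i hL)),
    pullback_FW₀_liouville i hL,
    extD_sub (hθ.pullback (contMDiff_π₁ i)) (hθ.pullback (hl.comp h2))]
  abel

theorem pullback_FW₀_symm_omega (hL : ContMDiff (IT E) 𝓘(ℝ, ℝ) ∞ L) :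
    pullback (IW₀ E E') (IW₀ E E') (FW₀ i L).symm (omega i) = omegaBar i L := by
  rw [← pullback_FW₀_omegaBar i hL,
    pullback_comp _ ((contMDiff_FW₀_symm i hL).mdifferentiable (by simp))
      ((contMDiff_FW₀ i hL).mdifferentiable (by simp)), Equiv.self_comp_symm]
  funext w
  ext u
  simp only [pullback, mfderiv_id]
  rfl

end Constrained

end Vakonomic

end

theorem mainTheorem5
    {E : Type*} [NormedAddCommGroup E] [NormedSpace ℝ E] [FiniteDimensional ℝ E]
    {Q : Type*} [TopologicalSpace Q] [ChartedSpace E Q] [IsManifold 𝓘(ℝ, E) ∞ Q]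
    {E' : Type*} [NormedAddCommGroup E'] [NormedSpace ℝ E'] [FiniteDimensional ℝ E']
    {M : Type*} [TopologicalSpace M] [ChartedSpace E' M] [IsManifold 𝓘(ℝ, E') ∞ M]
    (i : C^∞⟮𝓘(ℝ, E'), M; Vakonomic.IT E, Vakonomic.TB E Q⟯)
    (hi : IsSmoothEmbedding 𝓘(ℝ, E') (Vakonomic.IT E) ∞ i)
    (L : Vakonomic.TB E Q → ℝ) (hL : ContMDiff (Vakonomic.IT E) 𝓘(ℝ, ℝ) ∞ L) :
    -- the form `ω̄ = j^*(Ω + pr₂^* ω_L)` is `ω + (i ∘ π₂)^* ω_L`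
    Vakonomic.omegaBar i L = Vakonomic.omega i +
        Vakonomic.pullback (Vakonomic.IW₀ E E') (Vakonomic.IT E) (i ∘ Vakonomic.π₂ i)
          (Vakonomic.omegaL L) ∧
    -- `F|_{W₀}` is a diffeomorphism of `W₀`
    ContMDiff (Vakonomic.IW₀ E E') (Vakonomic.IW₀ E E') ∞ (Vakonomic.FW₀ i L) ∧
    ContMDiff (Vakonomic.IW₀ E E') (Vakonomic.IW₀ E E') ∞ (Vakonomic.FW₀ i L).symm ∧
    -- `TF⁻¹` maps solutions `Y` at `x` to solutions at `F⁻¹(x)`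
    (∀ (x : Vakonomic.W₀ i) (Y : TangentSpace (Vakonomic.IW₀ E E') x),
      Vakonomic.IsSolutionAt (Vakonomic.IW₀ E E') (Vakonomic.omegaBar i L)
        (Vakonomic.Hbar L ∘ Vakonomic.j i) x Y →
      Vakonomic.IsSolutionAt (Vakonomic.IW₀ E E') (Vakonomic.omega i) (Vakonomic.HW₀ i L)
        ((Vakonomic.FW₀ i L).symm x)
        (mfderiv (Vakonomic.IW₀ E E') (Vakonomic.IW₀ E E') (Vakonomic.FW₀ i L).symm x Y)) ∧
    -- `TF` maps solutions `X` at `F⁻¹(x)` to solutions at `x`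
    (∀ (x : Vakonomic.W₀ i)
      (X : TangentSpace (Vakonomic.IW₀ E E') ((Vakonomic.FW₀ i L).symm x)),
      Vakonomic.IsSolutionAt (Vakonomic.IW₀ E E') (Vakonomic.omega i) (Vakonomic.HW₀ i L)
        ((Vakonomic.FW₀ i L).symm x) X →
      Vakonomic.IsSolutionAt (Vakonomic.IW₀ E E') (Vakonomic.omegaBar i L)
        (Vakonomic.Hbar L ∘ Vakonomic.j i) x
        (mfderiv (Vakonomic.IW₀ E E') (Vakonomic.IW₀ E E') (Vakonomic.FW₀ i L)
          ((Vakonomic.FW₀ i L).symm x) X)) := by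

  have h₁ := (Vakonomic.contMDiff_FW₀ i hL).mdifferentiable (by simp)
  have h₂ := (Vakonomic.contMDiff_FW₀_symm i hL).mdifferentiable (by simp)
  refine ⟨Vakonomic.omegaBar_eq i, Vakonomic.contMDiff_FW₀ i hL,
    Vakonomic.contMDiff_FW₀_symm i hL, fun x Y hY => ?_, fun x X hX => ?_⟩
  -- Transport by `F⁻¹`, using `(F⁻¹)^*ω = ω̄` and `H_{W₀} ∘ F⁻¹ = H̄ ∘ j`.
  · refine Vakonomic.IsSolutionAt.map_diffeomorph h₂ h₁
      ((Vakonomic.contMDiff_HW₀ i hL).mdifferentiable (by simp)) ?_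
    rwa [Vakonomic.pullback_FW₀_symm_omega i hL, ← Vakonomic.Hbar_comp_j_FW₀,
      Function.comp_assoc, Equiv.self_comp_symm, Function.comp_id]
  · have h := Vakonomic.IsSolutionAt.map_diffeomorph h₁ h₂ (σ := Vakonomic.omegaBar i L)
      ((Vakonomic.contMDiff_Hbar_comp_j i hL).mdifferentiable (by simp))
      (x := (Vakonomic.FW₀ i L).symm x) (X := X)
      (by rwa [Vakonomic.pullback_FW₀_omegaBar i hL, Vakonomic.Hbar_comp_j_FW₀])
    rwa [Equiv.apply_symm_apply] at h
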